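/- Let $k$ be a field, let $\mathsf{Mat}\,k[s,s^{-1}]$ be the category with objects the natural numbers, arrows $m\to n$ the $n\times m$ matrices over $k[s,s^{-1}]$, and composition matrix multiplication. A corelation $m\xrightarrow{A}d\xleftarrow{B}n$ is a cospan in this category whose copairing $[A\ B]\colon m+n\to d$ is an epimorphism. Let $\mathsf{Corel}\,\mathsf{Mat}\,k[s,s^{-1}]$ be the category with objects the natural numbers and with arrows $m\to n$ the corelations, up to isomorphisms of the middle object that commute with the legs; two corelations are composed by taking the pushout of the inner legs, factorising the copairing of the resulting cospan as an epimorphism followed by a split monomorphism, and keeping the epimorphism. A matrix $S\colon e\to n$ gives the arrow $e\xrightarrow{S}n\xleftarrow{1}n$, a matrix $R\colon e\to m$ gives the arrow $m\xrightarrow{1}m\xleftarrow{R}e$, and a span $m\xleftarrow{R}e\xrightarrow{S}n$ denotes the composite $m\to e\to n$ of these two arrows. For an $n\times m$ matrix $A$ over $k[s,s^{-1}]$ let $\theta A\colon(k^m)^{\mathbb Z}\to(k^n)^{\mathbb Z}$ be the induced $k$-linear map, where $s$ acts on $k^{\mathbb Z}$ by $(s\cdot w)(t)=w(t-1)$. The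 behaviour of a morphism represented by $m\xrightarrow{A}d\xleftarrow{B}n$ is $$\Phi(\xrightarrow{A}\xleftarrow{B})=\{(\mathbf x,\mathbf y)\mid(\theta A)\mathbf x=(\theta B)\mathbf y\}=\ker\theta[A\ \,{-B}]\subseteq(k^m)^{\mathbb Z}\oplus(k^n)^{\mathbb Z},$$ whose elements are regarded as trajectories $\mathbb Z\to k^m\oplus k^n$. A set $\mathcal B$ of trajectories is controllable if for all $w,w'\in\mathcal B$ and all $t_0\in\mathbb Z$ there are $w''\in\mathcal B$ and $t_0'>t_0$ with $w''(t)=w(t)$ for $t\le t_0$ and $w''(t)=w'(t-t_0')$ for $t\ge t_0'$. **Theorem.** Let $m\xrightarrow{A}d\xleftarrow{B}n$ be a corelation in $\mathsf{Mat}\,k[s,s^{-1}]$. Then $\Phi(\xrightarrow{A}\xleftarrow{B})$ is controllable if and only if there exist a natural number $e$ and matrices $R\colon e\to m$, $S\colon e\to n$ such that $$m\xleftarrow{R}e\xrightarrow{S}n\;=\;m\xrightarrow{A}d\xleftarrow{B}n$$ as morphisms of $\mathsf{Corel}\,\mathsf{Mat}\,k[s,s^{-1}]$. Moreover, for every span $m\xleftarrow{R}e\xrightarrow{S}n$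 of matrices, $$\Phi(\xleftarrow{R}\xrightarrow{S})=\operatorname{im}\theta\begin{bmatrix}R\\S\end{bmatrix}.$$ -/

import Mathlib

open CategoryTheory CategoryTheory.Limits
open scoped LaurentPolynomial Matrix

noncomputable section

universe u

/-! ## The category of matrices over a ring -/

/-- The category `Mat R`: the objects are the natural numbers. -/
@[ext]
structure MatProp (R : Type u) where
  /-- the natural number underlying an object -/
  dim : ℕ

namespace MatProp

/-- Arrows `m → n` are the `n × m` matrices over `R`; composition is matrix multiplication. -/
instance category (R : Type u) [CommRing R] : Category (MatProp R) where
  Hom X Y := Matrix (Fin Y.dim) (Fin X.dim) R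
  id X := (1 : Matrix (Fin X.dim) (Fin X.dim) R)
  comp {X Y Z} (f : Matrix (Fin Y.dim) (Fin X.dim) R) (g : Matrix (Fin Z.dim) (Fin Y.dim) R) :=
    g * f
  id_comp f := Matrix.mul_one f
  comp_id f := Matrix.one_mul f
  assoc f g h := (Matrix.mul_assoc h g f).symm

variable {R : Type u} [CommRing R]

/-- An `n × m` matrix, regarded as an arrow `m → n`. -/
def ofMatrix {m n : ℕ} (A : Matrix (Fin n) (Fin m) R) :
    (⟨m⟩ : MatProp R) ⟶ (⟨n⟩ : MatProp R) := A

/-- The matrix of an arrow. -/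
def toMatrix {X Y : MatProp R} (f : X ⟶ Y) : Matrix (Fin Y.dim) (Fin X.dim) R := f

theorem toMatrix_comp {X Y Z : MatProp R} (f : X ⟶ Y) (g : Y ⟶ Z) :
    toMatrix (f ≫ g) = toMatrix g * toMatrix f := rfl

theorem hom_ext_row {X Y : MatProp R} {f g : X ⟶ Y}
    (h : ∀ i, toMatrix f i = toMatrix g i) : f = g := funext h

/-- Row `i` of a composite is the row `i` of the second factor times the first factor. -/
theorem toMatrix_comp_row {X Y Z : MatProp R} (f : X ⟶ Y) (g : Y ⟶ Z) (i : Fin Z.dim) :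
    toMatrix (f ≫ g) i = toMatrix g i ᵥ* toMatrix f := rfl

/-- The copairing `[A, B] : m + n → d` of `A : m → d` and `B : n → d`: the block matrix whose
first `m` columns are those of `A` and whose last `n` columns are those of `B`. -/
def copair {X Y Z : MatProp R} (A : X ⟶ Z) (B : Y ⟶ Z) :
    (⟨X.dim + Y.dim⟩ : MatProp R) ⟶ Z :=
  (Matrix.of fun i => Fin.append (toMatrix A i) (toMatrix B i) :
    Matrix (Fin Z.dim) (Fin (X.dim + Y.dim)) R)

/-- The first coprojection `m → m + n`. -/
def inl (X Y : MatProp R) : X ⟶ (⟨X.dim + Y.dim⟩ : MatProp R) :=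
  ((1 : Matrix (Fin (X.dim + Y.dim)) (Fin (X.dim + Y.dim)) R).submatrix id (Fin.castAdd Y.dim) :
    Matrix (Fin (X.dim + Y.dim)) (Fin X.dim) R)

/-- The second coprojection `n → m + n`. -/
def inr (X Y : MatProp R) : Y ⟶ (⟨X.dim + Y.dim⟩ : MatProp R) :=
  ((1 : Matrix (Fin (X.dim + Y.dim)) (Fin (X.dim + Y.dim)) R).submatrix id (Fin.natAdd X.dim) :
    Matrix (Fin (X.dim + Y.dim)) (Fin Y.dim) R)

theorem inl_comp_apply {X Y Z : MatProp R} (f : (⟨X.dim + Y.dim⟩ : MatProp R) ⟶ Z)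
    (i : Fin Z.dim) (j : Fin X.dim) :
    toMatrix (inl X Y ≫ f) i j = toMatrix f i (Fin.castAdd Y.dim j) := by
  rw [toMatrix_comp]
  simp [Matrix.mul_apply, toMatrix, inl, Matrix.one_apply]

theorem inr_comp_apply {X Y Z : MatProp R} (f : (⟨X.dim + Y.dim⟩ : MatProp R) ⟶ Z)
    (i : Fin Z.dim) (j : Fin Y.dim) :
    toMatrix (inr X Y ≫ f) i j = toMatrix f i (Fin.natAdd X.dim j) := by
  rw [toMatrix_comp]
  simp [Matrix.mul_apply, toMatrix, inr, Matrix.one_apply]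

theorem inl_copair {X Y Z : MatProp R} (A : X ⟶ Z) (B : Y ⟶ Z) :
    inl X Y ≫ copair A B = A := by
  refine hom_ext_row fun i => funext fun j => ?_
  rw [inl_comp_apply]
  exact Fin.append_left (toMatrix A i) (toMatrix B i) j

theorem inr_copair {X Y Z : MatProp R} (A : X ⟶ Z) (B : Y ⟶ Z) :
    inr X Y ≫ copair A B = B := by
  refine hom_ext_row fun i => funext fun j => ?_
  rw [inr_comp_apply]
  exact Fin.append_right (toMatrix A i) (toMatrix B i) j

theorem copair_hom_ext {X Y Z : MatProp R} {f g : (⟨X.dim + Y.dim⟩ : MatProp R) ⟶ Z}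
    (hl : inl X Y ≫ f = inl X Y ≫ g) (hr : inr X Y ≫ f = inr X Y ≫ g) : f = g := by
  refine hom_ext_row fun i => funext fun j => ?_
  refine Fin.addCases (fun j => ?_) (fun j => ?_) j
  · rw [← inl_comp_apply, ← inl_comp_apply, hl]
  · rw [← inr_comp_apply, ← inr_comp_apply, hr]

theorem copair_eq {X Y Z : MatProp R} (f : (⟨X.dim + Y.dim⟩ : MatProp R) ⟶ Z) :
    copair (inl X Y ≫ f) (inr X Y ≫ f) = f :=
  copair_hom_ext (inl_copair _ _) (inr_copair _ _)

/-! ### Factorisations and pushouts over a principal ideal domain -/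

variable [IsDomain R] [IsPrincipalIdealRing R]

/-- Every matrix factors as an epimorphism followed by a split monomorphism. -/
theorem exists_epi_splitMono {X Y : MatProp R} (f : X ⟶ Y) :
    ∃ (Z : MatProp R) (E : X ⟶ Z) (M : Z ⟶ Y), Epi E ∧ IsSplitMono M ∧ E ≫ M = f := by
  obtain ⟨d, ⟨b⟩⟩ := Submodule.nonempty_basis_of_pid (Pi.basisFun R (Fin X.dim))
    (LinearMap.range (toMatrix f).vecMulLinear)
  let E : X ⟶ (⟨d⟩ : MatProp R) := (Matrix.of fun i => (b i : Fin X.dim → R))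
  have hE : ∀ u : Fin d → R, u ᵥ* toMatrix E = ((∑ i, u i • b i :
      LinearMap.range (toMatrix f).vecMulLinear) : Fin X.dim → R) := by
    intro u
    rw [Matrix.vecMul_eq_sum]
    simp only [Submodule.coe_sum, Submodule.coe_smul]
    rfl
  have hepi : Epi E := by
    refine ⟨fun {W} g h hgh => hom_ext_row fun i => ?_⟩
    have h1 : toMatrix g i ᵥ* toMatrix E = toMatrix h i ᵥ* toMatrix E := by
      rw [← toMatrix_comp_row, ← toMatrix_comp_row, hgh]
    rw [hE, hE] at h1
    have h2 := congrArg b.repr (Subtype.ext h1)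
    have h3 : ∀ u : Fin d → R, ⇑(b.repr (∑ i, u i • b i)) = u := fun u => b.repr_sum_self u
    rw [← h3 (toMatrix g i), h2, h3]
  let M : (⟨d⟩ : MatProp R) ⟶ Y := (Matrix.of fun i => ⇑(b.repr ⟨toMatrix f i,
    ⟨Pi.single i 1, by simp [Matrix.vecMulLinear]; rfl⟩⟩))
  have hM : E ≫ M = f := by
    refine hom_ext_row fun i => ?_
    rw [toMatrix_comp_row, hE]
    exact congrArg Subtype.val (b.sum_repr ⟨toMatrix f i, _⟩)
  have hN : ∀ i, ∃ v : Fin Y.dim → R, v ᵥ* toMatrix f = b i := fun i => (b i).2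
  choose N hN using hN
  let N' : Y ⟶ (⟨d⟩ : MatProp R) := (Matrix.of N)
  have hN' : f ≫ N' = E := hom_ext_row fun i => hN i
  refine ⟨⟨d⟩, E, M, hepi, IsSplitMono.mk' ⟨N', ?_⟩, hM⟩
  rw [← cancel_epi E, ← Category.assoc, hM, hN', Category.comp_id]

instance hasPushouts : HasPushouts (MatProp R) := by
  have key : ∀ {X Y Z : MatProp R} (f : X ⟶ Y) (g : X ⟶ Z), HasPushout f g := by
    intro X Y Z f g
    let K : Submodule R ((Fin Y.dim → R) × (Fin Z.dim → R)) :=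
      LinearMap.eqLocus ((toMatrix f).vecMulLinear ∘ₗ LinearMap.fst R _ _)
        ((toMatrix g).vecMulLinear ∘ₗ LinearMap.snd R _ _)
    obtain ⟨d, ⟨b⟩⟩ := Submodule.nonempty_basis_of_pid
      ((Pi.basisFun R (Fin Y.dim)).prod (Pi.basisFun R (Fin Z.dim))) K
    let i₁ : Y ⟶ (⟨d⟩ : MatProp R) := (Matrix.of fun i => (b i).1.1)
    let i₂ : Z ⟶ (⟨d⟩ : MatProp R) := (Matrix.of fun i => (b i).1.2)
    have hE : ∀ u : Fin d → R, (u ᵥ* toMatrix i₁, u ᵥ* toMatrix i₂) =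
        ((∑ i, u i • b i : K) : (Fin Y.dim → R) × (Fin Z.dim → R)) := by
      intro u
      rw [Matrix.vecMul_eq_sum, Matrix.vecMul_eq_sum]
      refine Prod.ext ?_ ?_
      · simp [i₁, toMatrix, Prod.fst_sum]; rfl
      · simp [i₂, toMatrix, Prod.snd_sum]; rfl
    have hw : f ≫ i₁ = g ≫ i₂ := hom_ext_row fun i => (b i).2
    have hK : ∀ s : PushoutCocone f g, ∀ i, (toMatrix s.inl i, toMatrix s.inr i) ∈ K := by
      intro s i
      change toMatrix (f ≫ s.inl) i = toMatrix (g ≫ s.inr) i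
      rw [s.condition]
    let desc : ∀ s : PushoutCocone f g, (⟨d⟩ : MatProp R) ⟶ s.pt := fun s =>
      (Matrix.of fun i => ⇑(b.repr ⟨_, hK s i⟩))
    have hdesc : ∀ (s : PushoutCocone f g) i, (toMatrix (i₁ ≫ desc s) i, toMatrix (i₂ ≫ desc s) i)
        = (toMatrix s.inl i, toMatrix s.inr i) := by
      intro s i
      rw [toMatrix_comp_row, toMatrix_comp_row, hE]
      exact congrArg Subtype.val (b.sum_repr ⟨_, hK s i⟩)
    refine ⟨⟨⟨PushoutCocone.mk i₁ i₂ hw, PushoutCocone.IsColimit.mk hw desc ?_ ?_ ?_⟩⟩⟩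
    · exact fun s => hom_ext_row fun i => congrArg Prod.fst (hdesc s i)
    · exact fun s => hom_ext_row fun i => congrArg Prod.snd (hdesc s i)
    · intro s m h₁ h₂
      refine hom_ext_row fun i => ?_
      have h3 : ∀ u : Fin d → R, ⇑(b.repr (∑ i, u i • b i)) = u := fun u => b.repr_sum_self u
      have h1 : ((∑ j, toMatrix m i j • b j : K) : (Fin Y.dim → R) × (Fin Z.dim → R)) =
          (∑ j, toMatrix (desc s) i j • b j : K) := by
        rw [← hE, ← hE, ← toMatrix_comp_row, ← toMatrix_comp_row, h₁, h₂]
        exact (hdesc s i).symm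
      rw [← h3 (toMatrix m i), Subtype.ext h1, h3]
  exact hasPushouts_of_hasColimit_span _

end MatProp

/-! ## Corelations -/

open MatProp

section Corelation

variable {R : Type u} [CommRing R]

/-- A corelation `X → apex ← Y` in `Mat R`: a cospan that is jointly epic, that is, whose
copairing `X + Y → apex` is an epimorphism. -/
structure Corelation (X Y : MatProp R) where
  /-- the middle object -/
  apex : MatProp R
  /-- the left leg -/
  left : X ⟶ apex
  /-- the right leg -/
  right : Y ⟶ apex
  /-- the legs are jointly epic -/
  epi : Epi (copair left right)

namespace Corelation

/-- Two cospans are equivalent if there is an isomorphism of their middle objects that commutes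
with the legs. -/
def IsEquiv {X Y : MatProp R} (c c' : Corelation X Y) : Prop :=
  ∃ φ : c.apex ≅ c'.apex, c.left ≫ φ.hom = c'.left ∧ c.right ≫ φ.hom = c'.right

instance setoid (X Y : MatProp R) : Setoid (Corelation X Y) where
  r := IsEquiv
  iseqv :=
    { refl := fun c => ⟨Iso.refl _, Category.comp_id _, Category.comp_id _⟩
      symm := by
        rintro c c' ⟨φ, h₁, h₂⟩
        exact ⟨φ.symm, by simp [← h₁], by simp [← h₂]⟩
      trans := by
        rintro c c' c'' ⟨φ, h₁, h₂⟩ ⟨ψ, h₃, h₄⟩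
        exact ⟨φ ≪≫ ψ, by simp [← h₃, ← h₁], by simp [← h₄, ← h₂]⟩ }

/-- The relation between arrows into `T` that a cospan induces; it serves to verify the laws
of the category of corelations. -/
def Rel {X Y Z : MatProp R} (A : X ⟶ Z) (B : Y ⟶ Z) (T : MatProp R) (x : X ⟶ T) (y : Y ⟶ T) :
    Prop := ∃ u : Z ⟶ T, A ≫ u = x ∧ B ≫ u = y

theorem isEquiv_of_rel {X Y : MatProp R} {c c' : Corelation X Y}
    (h : ∀ T x y, Rel c.left c.right T x y ↔ Rel c'.left c'.right T x y) : c ≈ c' := by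
  obtain ⟨f, hf₁, hf₂⟩ := (h _ _ _).2 ⟨𝟙 _, Category.comp_id c'.left, Category.comp_id c'.right⟩
  obtain ⟨g, hg₁, hg₂⟩ := (h _ _ _).1 ⟨𝟙 _, Category.comp_id c.left, Category.comp_id c.right⟩
  have e := c.epi
  have e' := c'.epi
  refine ⟨⟨f, g, ?_, ?_⟩, hf₁, hf₂⟩
  · rw [← cancel_epi (copair c.left c.right)]
    refine copair_hom_ext ?_ ?_
    · simp only [← Category.assoc, inl_copair, Category.comp_id, hf₁, hg₁]
    · simp only [← Category.assoc, inr_copair, Category.comp_id, hf₂, hg₂]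
  · rw [← cancel_epi (copair c'.left c'.right)]
    refine copair_hom_ext ?_ ?_
    · simp only [← Category.assoc, inl_copair, Category.comp_id, hf₁, hg₁]
    · simp only [← Category.assoc, inr_copair, Category.comp_id, hf₂, hg₂]

theorem rel_of_isEquiv {X Y : MatProp R} {c c' : Corelation X Y} (h : c ≈ c')
    (T : MatProp R) (x : X ⟶ T) (y : Y ⟶ T) :
    Rel c.left c.right T x y ↔ Rel c'.left c'.right T x y := by
  obtain ⟨φ, h₁, h₂⟩ := h
  constructor
  · rintro ⟨u, rfl, rfl⟩
    exact ⟨φ.inv ≫ u, by simp [← h₁], by simp [← h₂]⟩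
  · rintro ⟨u, rfl, rfl⟩
    exact ⟨φ.hom ≫ u, by simp [← h₁], by simp [← h₂]⟩

variable [IsDomain R] [IsPrincipalIdealRing R]

theorem exists_ofCospan {X Y Z : MatProp R} (A : X ⟶ Z) (B : Y ⟶ Z) :
    ∃ (c : Corelation X Y) (M : c.apex ⟶ Z), IsSplitMono M ∧
      copair c.left c.right ≫ M = copair A B := by
  obtain ⟨W, E, M, hE, hM, h⟩ := exists_epi_splitMono (copair A B)
  exact ⟨⟨W, inl X Y ≫ E, inr X Y ≫ E, by rwa [copair_eq]⟩, M, hM, by simpa only [copair_eq]⟩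

/-- The jointly epic part of a cospan: its copairing is factorised as an epimorphism followed by
a split monomorphism, and the epimorphism is kept. -/
def ofCospan {X Y Z : MatProp R} (A : X ⟶ Z) (B : Y ⟶ Z) : Corelation X Y :=
  (exists_ofCospan A B).choose

theorem ofCospan_spec {X Y Z : MatProp R} (A : X ⟶ Z) (B : Y ⟶ Z) :
    ∃ M : (ofCospan A B).apex ⟶ Z, IsSplitMono M ∧
      copair (ofCospan A B).left (ofCospan A B).right ≫ M = copair A B :=
  (exists_ofCospan A B).choose_spec

theorem rel_ofCospan {X Y Z : MatProp R} (A : X ⟶ Z) (B : Y ⟶ Z) (T : MatProp R)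
    (x : X ⟶ T) (y : Y ⟶ T) :
    Rel (ofCospan A B).left (ofCospan A B).right T x y ↔ Rel A B T x y := by
  obtain ⟨M, hM, h⟩ := ofCospan_spec A B
  have hl : (ofCospan A B).left ≫ M = A := by
    have := congrArg (inl X Y ≫ ·) h
    simpa only [← Category.assoc, inl_copair] using this
  have hr : (ofCospan A B).right ≫ M = B := by
    have := congrArg (inr X Y ≫ ·) h
    simpa only [← Category.assoc, inr_copair] using this
  constructor
  · rintro ⟨u, rfl, rfl⟩
    refine ⟨retraction M ≫ u, ?_, ?_⟩
    · nth_rewrite 1 [← hl]; simp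
    · nth_rewrite 1 [← hr]; simp
  · rintro ⟨u, rfl, rfl⟩
    exact ⟨M ≫ u, by rw [← Category.assoc, hl], by rw [← Category.assoc, hr]⟩

/-- The composite of two corelations: the pushout of the two inner legs, followed by the passage
to the jointly epic part. -/
def comp {X Y Z : MatProp R} (c : Corelation X Y) (c' : Corelation Y Z) : Corelation X Z :=
  ofCospan (c.left ≫ pushout.inl c.right c'.left) (c'.right ≫ pushout.inr c.right c'.left)

theorem rel_comp {X Y Z : MatProp R} (c : Corelation X Y) (c' : Corelation Y Z) (T : MatProp R)
    (x : X ⟶ T) (z : Z ⟶ T) :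
    Rel (c.comp c').left (c.comp c').right T x z ↔
      ∃ y, Rel c.left c.right T x y ∧ Rel c'.left c'.right T y z := by
  rw [comp, rel_ofCospan]
  constructor
  · rintro ⟨u, rfl, rfl⟩
    refine ⟨c.right ≫ pushout.inl c.right c'.left ≫ u, ⟨_, (Category.assoc _ _ _).symm, rfl⟩,
      ⟨pushout.inr c.right c'.left ≫ u, ?_, (Category.assoc _ _ _).symm⟩⟩
    rw [← Category.assoc, ← pushout.condition, Category.assoc]
  · rintro ⟨y, ⟨u, rfl, hu⟩, ⟨v, hv, rfl⟩⟩
    refine ⟨pushout.desc u v (hu.trans hv.symm), ?_, ?_⟩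
    · rw [Category.assoc, pushout.inl_desc]
    · rw [Category.assoc, pushout.inr_desc]

/-- The corelation `m → n = n` given by a matrix `m → n`. -/
def ofHom {X Y : MatProp R} (f : X ⟶ Y) : Corelation X Y where
  apex := Y
  left := f
  right := 𝟙 Y
  epi := ⟨fun g h hgh => by
    have := congrArg (inr X Y ≫ ·) hgh
    simpa only [← Category.assoc, inr_copair, Category.id_comp] using this⟩

/-- The corelation `n = n ← m` given by a matrix `m → n`. -/
def ofHomOp {X Y : MatProp R} (f : X ⟶ Y) : Corelation Y X where
  apex := Y
  left := 𝟙 Y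
  right := f
  epi := ⟨fun g h hgh => by
    have := congrArg (inl Y X ≫ ·) hgh
    simpa only [← Category.assoc, inl_copair, Category.id_comp] using this⟩

end Corelation

end Corelation

/-- The category `Corel Mat R`: the objects are the natural numbers. -/
@[ext]
structure CorelMat (R : Type u) where
  /-- the natural number underlying an object, as an object of `Mat R` -/
  obj : MatProp R

namespace CorelMat

variable {R : Type u} [CommRing R] [IsDomain R] [IsPrincipalIdealRing R]

/-- Arrows are equivalence classes of jointly epic cospans; composition is induced by
`Corelation.comp`, and the identities are the classes of the identity cospans. -/
instance category : Category (CorelMat R) where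
  Hom X Y := Quotient (Corelation.setoid X.obj Y.obj)
  id X := Quotient.mk _ (Corelation.ofHom (𝟙 X.obj))
  comp := Quotient.map₂ Corelation.comp (by
    intro c₁ c₁' h c₂ c₂' h'
    refine Corelation.isEquiv_of_rel fun T x z => ?_
    simp only [Corelation.rel_comp, Corelation.rel_of_isEquiv h, Corelation.rel_of_isEquiv h'])
  id_comp := by
    rintro X Y ⟨c⟩
    refine Quotient.sound (Corelation.isEquiv_of_rel fun T x z => ?_)
    rw [Corelation.rel_comp]
    simp [Corelation.Rel, Corelation.ofHom]
  comp_id := by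
    rintro X Y ⟨c⟩
    refine Quotient.sound (Corelation.isEquiv_of_rel fun T x z => ?_)
    rw [Corelation.rel_comp]
    simp [Corelation.Rel, Corelation.ofHom]
  assoc := by
    rintro W X Y Z ⟨c⟩ ⟨c'⟩ ⟨c''⟩
    refine Quotient.sound (Corelation.isEquiv_of_rel fun T x z => ?_)
    simp only [Corelation.rel_comp]
    constructor
    · rintro ⟨y, ⟨y', h₁, h₂⟩, h₃⟩
      exact ⟨y', h₁, y, h₂, h₃⟩
    · rintro ⟨y', h₁, y, h₂, h₃⟩
      exact ⟨y, ⟨y', h₁, h₂⟩, h₃⟩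

/-- The natural number `n`, regarded as an object of `Corel Mat R`. -/
abbrev of (R : Type u) (n : ℕ) : CorelMat R := ⟨⟨n⟩⟩

/-- The morphism `m → n` of `Corel Mat R` represented by a jointly epic cospan of matrices
`m → d ← n`. -/
def ofCospan {m d n : ℕ} (A : Matrix (Fin d) (Fin m) R) (B : Matrix (Fin d) (Fin n) R)
    (h : Epi (copair (ofMatrix A) (ofMatrix B))) : of R m ⟶ of R n :=
  Quotient.mk _ (⟨⟨d⟩, ofMatrix A, ofMatrix B, h⟩ : Corelation (⟨m⟩ : MatProp R) ⟨n⟩)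

/-- The morphism `m → n` of `Corel Mat R` given by an `n × m` matrix. -/
def ofHom {m n : ℕ} (S : Matrix (Fin n) (Fin m) R) : of R m ⟶ of R n :=
  Quotient.mk _ (Corelation.ofHom (ofMatrix S))

/-- The morphism `n → m` of `Corel Mat R` given by an `n × m` matrix, read backwards. -/
def ofHomOp {m n : ℕ} (S : Matrix (Fin n) (Fin m) R) : of R n ⟶ of R m :=
  Quotient.mk _ (Corelation.ofHomOp (ofMatrix S))

/-- The morphism `m → n` of `Corel Mat R` given by a span of matrices `m ← e → n`: the composite
of the first leg, read backwards, and the second leg. -/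
def ofSpan {m e n : ℕ} (P : Matrix (Fin m) (Fin e) R) (S : Matrix (Fin n) (Fin e) R) :
    of R m ⟶ of R n :=
  ofHomOp P ≫ ofHom S

end CorelMat

/-! ## Laurent polynomials over a field and biinfinite streams -/

instance LaurentPolynomial.isPrincipalIdealRing_of_field (k : Type u) [Field k] :
    IsPrincipalIdealRing k[T;T⁻¹] := by
  refine ⟨fun I => ?_⟩
  rw [← IsLocalization.map_under (Submonoid.powers (Polynomial.X : Polynomial k)) k[T;T⁻¹] I]
  obtain ⟨a, ha⟩ := IsPrincipalIdealRing.principal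
    (I.under (Polynomial k))
  rw [ha, Ideal.submodule_span_eq, Ideal.map_span, Set.image_singleton]
  exact ⟨⟨_, rfl⟩⟩

section Behaviour

variable {k : Type u} [Field k]

/-- The delay by `i` steps on biinfinite streams: `(delay i w) t = w (t - i)`. -/
def delay (i : ℤ) : (ℤ → k) →ₗ[k] (ℤ → k) := LinearMap.funLeft k k fun t => t - i

/-- The action of `k[s, s⁻¹]` on biinfinite streams: the `k`-algebra homomorphism under which
`s ^ i` acts as the delay by `i` steps. -/
def laurentAction (k : Type u) [Field k] : k[T;T⁻¹] →ₐ[k] Module.End k (ℤ → k) :=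
  AddMonoidAlgebra.lift k (Module.End k (ℤ → k)) ℤ
    { toFun := fun i => delay i.toAdd
      map_one' := by
        ext w t
        simp [delay, LinearMap.funLeft]
      map_mul' := fun i j => by
        refine LinearMap.ext fun w => funext fun t => ?_
        simp [delay, LinearMap.funLeft, sub_sub] }

/-- The linear map `θ A : (k ^ m) ^ ℤ → (k ^ n) ^ ℤ` induced by an `n × m` matrix `A` over
`k[s, s⁻¹]`: the `i`-th component of `θ A w` is the sum over `j` of `A i j` applied to the
`j`-th component of `w`. -/
def theta {m n : ℕ} (A : Matrix (Fin n) (Fin m) k[T;T⁻¹]) :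
    (ℤ → Fin m → k) →ₗ[k] (ℤ → Fin n → k) where
  toFun w t i := ∑ j, laurentAction k (A i j) (fun τ => w τ j) t
  map_add' v w := by
    funext t i
    simp only [Pi.add_apply, ← Finset.sum_add_distrib]
    refine Finset.sum_congr rfl fun j _ => ?_
    exact congrFun (map_add (laurentAction k (A i j)) (fun τ => v τ j) (fun τ => w τ j)) t
  map_smul' a w := by
    funext t i
    simp only [Pi.smul_apply, RingHom.id_apply, Finset.smul_sum]
    refine Finset.sum_congr rfl fun j _ => ?_
    exact congrFun (map_smul (laurentAction k (A i j)) a (fun τ => w τ j)) t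

theorem theta_mul {l m n : ℕ} (A : Matrix (Fin n) (Fin m) k[T;T⁻¹])
    (B : Matrix (Fin m) (Fin l) k[T;T⁻¹]) (w : ℤ → Fin l → k) :
    theta (A * B) w = theta A (theta B w) := by
  funext t i
  have h : ∀ j, (fun τ => theta B w τ j) =
      ∑ r, laurentAction k (B j r) (fun τ => w τ r) := fun j => by
    funext τ
    simp [theta]
  simp only [theta, LinearMap.coe_mk, AddHom.coe_mk] at h ⊢
  simp only [h, Matrix.mul_apply, map_sum, map_mul, LinearMap.sum_apply, Finset.sum_apply,
    Module.End.mul_apply]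
  exact Finset.sum_comm

theorem theta_one {n : ℕ} (w : ℤ → Fin n → k) :
    theta (1 : Matrix (Fin n) (Fin n) k[T;T⁻¹]) w = w := by
  funext t i
  simp only [theta, LinearMap.coe_mk, AddHom.coe_mk]
  rw [Finset.sum_eq_single i]
  · simp
  · intro j _ hj
    simp [Matrix.one_apply_ne hj.symm]
  · simp

/-- The behaviour of a cospan of matrices `m → d ← n`: the pairs `(x, y)` of trajectories with
`θ A x = θ B y`, that is, the kernel of `θ [A  -B]`. -/
def cospanBehaviour {m d n : ℕ} (A : Matrix (Fin d) (Fin m) k[T;T⁻¹])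
    (B : Matrix (Fin d) (Fin n) k[T;T⁻¹]) :
    Submodule k ((ℤ → Fin m → k) × (ℤ → Fin n → k)) :=
  LinearMap.eqLocus (theta A ∘ₗ LinearMap.fst k _ _) (theta B ∘ₗ LinearMap.snd k _ _)

/-- The behaviour `Φ c` of a morphism `c : m → n` of `Corel Mat k[s, s⁻¹]`, computed on any
representing cospan. -/
def behaviour {X Y : CorelMat k[T;T⁻¹]} (c : X ⟶ Y) :
    Submodule k ((ℤ → Fin X.obj.dim → k) × (ℤ → Fin Y.obj.dim → k)) :=
  Quotient.lift
    (fun c : Corelation X.obj Y.obj => cospanBehaviour (toMatrix c.left) (toMatrix c.right))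
    (by
      rintro c c' ⟨φ, h₁, h₂⟩
      ext ⟨x, y⟩
      change theta (toMatrix c.left) x = theta (toMatrix c.right) y ↔
        theta (toMatrix c'.left) x = theta (toMatrix c'.right) y
      rw [← h₁, ← h₂, toMatrix_comp, toMatrix_comp, theta_mul, theta_mul]
      refine ⟨fun h => by rw [h], fun h => ?_⟩
      have h3 := congrArg (theta (toMatrix φ.inv)) h
      have h4 : toMatrix φ.inv * toMatrix φ.hom = 1 := φ.hom_inv_id
      rwa [← theta_mul (toMatrix φ.inv) (toMatrix φ.hom), ← theta_mul (toMatrix φ.inv) (toMatrix φ.hom),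
        h4, theta_one, theta_one] at h3) c

/-- The set of trajectories `ℤ → V × W` that corresponds to a set of pairs of trajectories. -/
def trajectories {V W : Type*} (B : Set ((ℤ → V) × (ℤ → W))) : Set (ℤ → V × W) :=
  {w | (fun t => (w t).1, fun t => (w t).2) ∈ B}

/-- Controllability of a behaviour with time axis `ℤ` and signal space `W`, in the sense of
Willems: from the past of any trajectory one can pass, in finite time, to the future of any
other one. -/
def IsControllable {W : Type*} (B : Set (ℤ → W)) : Prop :=
  ∀ w ∈ B, ∀ w' ∈ B, ∀ t₀ : ℤ, ∃ w'' ∈ B, ∃ t₁ : ℤ, t₀ < t₁ ∧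
    (∀ t ≤ t₀, w'' t = w t) ∧ (∀ t ≥ t₁, w'' t = w' (t - t₁))

end Behaviour

end

/-!
The rows of a cospan of matrices `m → d ← n` over `L = k[T;T⁻¹]` span a submodule `N` of
`L ^ m × L ^ n`. A corelation is determined by its `N` (`Corelation.equiv_iff_rowModule_eq`), and
the corelation of a span `m ← e → n` with legs `P`, `S` corresponds to the kernel of
`(p, r) ↦ p P - r S` (`Corelation.rowModule_comp_ofHomOp_ofHom`). Over a principal ideal domain
the submodules of this form are those with torsion-free quotient
(`Corelation.exists_ker_spanMap_eq` gives the direction that is needed).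

Trajectories are the `k`-linear dual of rows (`exists_rowAction_eq`): a trajectory acts on a row
of Laurent polynomials by the value at time `0` of the result. Under this duality the behaviour of
a cospan is the annihilator of `N`, for the pairing with a minus sign on the second block
(`mem_cospanBehaviour_iff`), the map `θ A` is the transpose of
multiplication of rows by `A`, and exactness of linear duality over the field `k` gives both that
the behaviour of a span is an image (`behaviour_ofSpan`) and that the behaviour determines `N`
(`mem_rowModule_of_forall_pairAction`).

Images are controllable, because `θ` has finite memory and trajectories of the apex can be
concatenated freely (`isControllable_range_theta`). Conversely, let the behaviour be controllable
and let `q p` lie in `N` with `q ≠ 0`. For a trajectory `w` of the behaviour the scalar trajectory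
`p · w` is a solution of the recurrence `q`. Steering `w` to zero turns it into a solution that
vanishes from some time on, hence everywhere, while its past is kept; so `p · w = 0` at all
times, and `p` lies in `N` (`mem_rowModule_of_smul_mem`). Thus `N` has torsion-free quotient, and
the corelation comes from a span.
-/

noncomputable section

universe u

open MatProp

/-! ### Corelations and submodules of rows -/

namespace Corelation

section Rows

variable {R : Type u} [CommRing R]

/-- The module of rows of a cospan `X → Z ← Y`: the row space of the block matrix `[A  B]`,
with every row split into its two blocks. -/
def rowModule {X Y Z : MatProp R} (A : X ⟶ Z) (B : Y ⟶ Z) :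
    Submodule R ((Fin X.dim → R) × (Fin Y.dim → R)) :=
  LinearMap.range ((toMatrix A).vecMulLinear.prod (toMatrix B).vecMulLinear)

theorem mem_rowModule {X Y Z : MatProp R} {A : X ⟶ Z} {B : Y ⟶ Z}
    {p : (Fin X.dim → R) × (Fin Y.dim → R)} :
    p ∈ rowModule A B ↔ ∃ u, u ᵥ* toMatrix A = p.1 ∧ u ᵥ* toMatrix B = p.2 := by
  simp [rowModule, Prod.ext_iff]

theorem rel_iff_forall_mem_rowModule {X Y Z T : MatProp R} {A : X ⟶ Z} {B : Y ⟶ Z}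
    {x : X ⟶ T} {y : Y ⟶ T} :
    Rel A B T x y ↔ ∀ i, (toMatrix x i, toMatrix y i) ∈ rowModule A B := by
  constructor
  · rintro ⟨u, rfl, rfl⟩ i
    exact mem_rowModule.2 ⟨toMatrix u i, rfl, rfl⟩
  · intro h
    choose u hu using fun i => mem_rowModule.1 (h i)
    exact ⟨Matrix.of u, hom_ext_row fun i => (hu i).1, hom_ext_row fun i => (hu i).2⟩

theorem mem_rowModule_iff_rel {X Y Z : MatProp R} {A : X ⟶ Z} {B : Y ⟶ Z}
    {p : (Fin X.dim → R) × (Fin Y.dim → R)} :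
    p ∈ rowModule A B ↔ Rel A B ⟨1⟩ (Matrix.of fun _ => p.1) (Matrix.of fun _ => p.2) := by
  rw [rel_iff_forall_mem_rowModule]
  exact ⟨fun h _ => h, fun h => h 0⟩

/-- A corelation is determined by its module of rows: over jointly epic cospans the rows form
a basis of that module. -/
theorem equiv_iff_rowModule_eq {X Y : MatProp R} {c c' : Corelation X Y} :
    c ≈ c' ↔ rowModule c.left c.right = rowModule c'.left c'.right := by
  constructor
  · intro h
    ext p
    rw [mem_rowModule_iff_rel, mem_rowModule_iff_rel, rel_of_isEquiv h]
  · intro h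
    refine isEquiv_of_rel fun T x y => ?_
    rw [rel_iff_forall_mem_rowModule, rel_iff_forall_mem_rowModule, h]

/-- The map whose kernel consists of the pairs of rows `(p, r)` with `p P = r S`. -/
def spanMap {m e n : ℕ} (P : Matrix (Fin m) (Fin e) R) (S : Matrix (Fin n) (Fin e) R) :
    (Fin m → R) × (Fin n → R) →ₗ[R] (Fin e → R) :=
  P.vecMulLinear.coprod (-S.vecMulLinear)

theorem spanMap_apply {m e n : ℕ} (P : Matrix (Fin m) (Fin e) R) (S : Matrix (Fin n) (Fin e) R)
    (p : (Fin m → R) × (Fin n → R)) : spanMap P S p = p.1 ᵥ* P - p.2 ᵥ* S := by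
  simp [spanMap, sub_eq_add_neg]

variable [IsDomain R] [IsPrincipalIdealRing R]

theorem rowModule_comp_ofHomOp_ofHom {m e n : ℕ} (P : Matrix (Fin m) (Fin e) R)
    (S : Matrix (Fin n) (Fin e) R) :
    rowModule ((ofHomOp (ofMatrix P)).comp (ofHom (ofMatrix S))).left
      ((ofHomOp (ofMatrix P)).comp (ofHom (ofMatrix S))).right =
      LinearMap.ker (spanMap P S) := by
  ext p
  rw [mem_rowModule_iff_rel, rel_comp, LinearMap.mem_ker, spanMap_apply, sub_eq_zero]
  constructor
  · rintro ⟨y, ⟨u, hu, hu'⟩, ⟨v, hv, hv'⟩⟩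
    obtain rfl : u = _ := (Category.id_comp u).symm.trans hu
    obtain rfl : v = _ := (Category.id_comp v).symm.trans hv'
    exact congrFun (hu'.trans hv.symm) 0
  · intro h
    exact ⟨_, ⟨_, Category.id_comp _, rfl⟩,
      ⟨_, (hom_ext_row fun _ => h.symm : ofMatrix S ≫ _ = ofMatrix P ≫ _), Category.id_comp _⟩⟩

theorem ofSpan_eq_ofCospan_iff {m d n e : ℕ} {A : Matrix (Fin d) (Fin m) R}
    {B : Matrix (Fin d) (Fin n) R} {h : Epi (copair (ofMatrix A) (ofMatrix B))}
    {P : Matrix (Fin m) (Fin e) R} {S : Matrix (Fin n) (Fin e) R} :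
    CorelMat.ofSpan P S = CorelMat.ofCospan A B h ↔
      LinearMap.ker (spanMap P S) = rowModule (ofMatrix A) (ofMatrix B) := by
  rw [← rowModule_comp_ofHomOp_ofHom]
  exact Quotient.eq.trans equiv_iff_rowModule_eq

/-- A submodule with torsion-free quotient is the kernel of a map to a finite free module, since
its quotient is itself finite free over a principal ideal domain. -/
theorem exists_ker_spanMap_eq {m n : ℕ} (N : Submodule R ((Fin m → R) × (Fin n → R)))
    (hN : ∀ (q : R) p, q ≠ 0 → q • p ∈ N → p ∈ N) :
    ∃ (e : ℕ) (P : Matrix (Fin m) (Fin e) R) (S : Matrix (Fin n) (Fin e) R),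
      LinearMap.ker (spanMap P S) = N := by
  have htf : Module.IsTorsionFree R (((Fin m → R) × (Fin n → R)) ⧸ N) := by
    refine ⟨fun q hq => isSMulRegular_iff_right_eq_zero_of_smul.2 fun x hx => ?_⟩
    induction x using Submodule.Quotient.induction_on with | _ p => ?_
    rw [← Submodule.Quotient.mk_smul, Submodule.Quotient.mk_eq_zero] at hx
    rw [Submodule.Quotient.mk_eq_zero]
    exact hN q p hq.ne_zero hx
  obtain ⟨e, b⟩ := Module.basisOfFiniteTypeTorsionFree' (R := R)
    (M := ((Fin m → R) × (Fin n → R)) ⧸ N)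
  let g : (Fin m → R) × (Fin n → R) →ₗ[R] (Fin e → R) := b.equivFun.toLinearMap ∘ₗ N.mkQ
  refine ⟨e, LinearMap.toMatrixRight' (g ∘ₗ LinearMap.inl R _ _),
    LinearMap.toMatrixRight' (-(g ∘ₗ LinearMap.inr R _ _)), ?_⟩
  have hg : spanMap (LinearMap.toMatrixRight' (g ∘ₗ LinearMap.inl R _ _))
      (LinearMap.toMatrixRight' (-(g ∘ₗ LinearMap.inr R _ _))) = g := by
    have key : ∀ {l : ℕ} (f : (Fin l → R) →ₗ[R] (Fin e → R)) v,
        v ᵥ* LinearMap.toMatrixRight' f = f v := fun f v =>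
      LinearMap.congr_fun (LinearMap.toMatrixRight'.symm_apply_apply f) v
    refine LinearMap.ext fun p => ?_
    rw [spanMap_apply, key, key, LinearMap.neg_apply, sub_neg_eq_add]
    simp [← map_add]
  rw [hg]
  ext p
  simp [g]

end Rows

end Corelation

/-! ### Rows of Laurent polynomials as functionals on trajectories -/

section Duality

variable {k : Type u} [Field k]

theorem laurentAction_apply (p : k[T;T⁻¹]) (w : ℤ → k) (t : ℤ) :
    laurentAction k p w t = p.coeff.sum fun i a => a * w (t - i) := by
  rw [laurentAction, AddMonoidAlgebra.lift_apply, Finsupp.sum, Finsupp.sum, LinearMap.sum_apply,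
    Finset.sum_apply]
  rfl

theorem laurentAction_T (i : ℤ) (w : ℤ → k) (t : ℤ) :
    laurentAction k (LaurentPolynomial.T i) w t = w (t - i) := by
  rw [laurentAction_apply, LaurentPolynomial.T, AddMonoidAlgebra.coeff_single,
    Finsupp.sum_single_index (by simp), one_mul]

/-- The action of a row `p` of Laurent polynomials on a vector-valued trajectory `w`: the scalar
trajectory `∑ j, p j · w j`. -/
def rowAction {n : ℕ} (w : ℤ → Fin n → k) : (Fin n → k[T;T⁻¹]) →ₗ[k] (ℤ → k) where
  toFun p := ∑ j, laurentAction k (p j) fun τ => w τ j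
  map_add' p q := by simp [Finset.sum_add_distrib]
  map_smul' a p := by simp [Finset.smul_sum]

theorem rowAction_apply {n : ℕ} (w : ℤ → Fin n → k) (p : Fin n → k[T;T⁻¹]) :
    rowAction w p = ∑ j, laurentAction k (p j) fun τ => w τ j := rfl

theorem theta_apply {m n : ℕ} (A : Matrix (Fin n) (Fin m) k[T;T⁻¹]) (w : ℤ → Fin m → k)
    (t : ℤ) (i : Fin n) : theta A w t i = rowAction w (A i) t := by
  simp [theta, rowAction_apply]

theorem rowAction_theta {m n : ℕ} (A : Matrix (Fin n) (Fin m) k[T;T⁻¹]) (w : ℤ → Fin m → k)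
    (p : Fin n → k[T;T⁻¹]) : rowAction (theta A w) p = rowAction w (p ᵥ* A) := by
  funext t
  have h := theta_apply (Matrix.replicateRow (Fin 1) p * A) w t 0
  rw [theta_mul, theta_apply] at h
  exact h

theorem rowAction_smul {n : ℕ} (w : ℤ → Fin n → k) (q : k[T;T⁻¹]) (p : Fin n → k[T;T⁻¹]) :
    rowAction w (q • p) = laurentAction k q (rowAction w p) := by
  simp [rowAction_apply]

theorem rowAction_single {n : ℕ} (w : ℤ → Fin n → k) (j : Fin n) (i t : ℤ) :
    rowAction w (Pi.single j (LaurentPolynomial.T i)) t = w (t - i) j := by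
  rw [rowAction_apply, Finset.sum_eq_single j]
  · rw [Pi.single_eq_same, laurentAction_T]
  · intro l _ hl
    simp [Pi.single_eq_of_ne hl]
  · simp

theorem rowAction_injective {n : ℕ} {w w' : ℤ → Fin n → k}
    (h : ∀ p, rowAction w p 0 = rowAction w' p 0) : w = w' := by
  funext t j
  simpa [rowAction_single] using h (Pi.single j (LaurentPolynomial.T (-t)))

/-- The trajectories with values in `k ^ n` are the linear dual of the space of rows: every
functional on rows is the value at time `0` of the action on a trajectory. -/
theorem exists_rowAction_eq {n : ℕ} (μ : Module.Dual k (Fin n → k[T;T⁻¹])) :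
    ∃ w : ℤ → Fin n → k, ∀ p, rowAction w p 0 = μ p := by
  refine ⟨fun t j => μ (Pi.single j (LaurentPolynomial.T (-t))), fun p => ?_⟩
  suffices LinearMap.proj 0 ∘ₗ rowAction
      (fun t j => μ (Pi.single j (LaurentPolynomial.T (-t)))) = μ from LinearMap.congr_fun this p
  refine LinearMap.pi_ext fun j q => ?_
  induction q using LaurentPolynomial.induction_on' with
  | add q q' h h' => rw [Pi.single_add, map_add, map_add, h, h']
  | C_mul_T i a =>
    have : (Pi.single j (LaurentPolynomial.C a * LaurentPolynomial.T i) : Fin n → k[T;T⁻¹]) =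
        a • Pi.single j (LaurentPolynomial.T i) := by
      rw [← Pi.single_smul, LaurentPolynomial.smul_eq_C_mul]
    rw [this, map_smul, map_smul]
    simp [rowAction_single]

/-- The pairing of two trajectories with a pair of rows, signed so that it vanishes on the rows
of a cospan `m → d ← n` exactly for the trajectories of its behaviour. -/
def pairAction {m n : ℕ} (x : ℤ → Fin m → k) (y : ℤ → Fin n → k) :
    (Fin m → k[T;T⁻¹]) × (Fin n → k[T;T⁻¹]) →ₗ[k] (ℤ → k) :=
  (rowAction x).coprod (-rowAction y)

theorem pairAction_apply {m n : ℕ} (x : ℤ → Fin m → k) (y : ℤ → Fin n → k)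
    (p : (Fin m → k[T;T⁻¹]) × (Fin n → k[T;T⁻¹])) :
    pairAction x y p = rowAction x p.1 - rowAction y p.2 := by
  simp [pairAction, sub_eq_add_neg]

theorem pairAction_smul {m n : ℕ} (x : ℤ → Fin m → k) (y : ℤ → Fin n → k) (q : k[T;T⁻¹])
    (p : (Fin m → k[T;T⁻¹]) × (Fin n → k[T;T⁻¹])) :
    pairAction x y (q • p) = laurentAction k q (pairAction x y p) := by
  rw [pairAction_apply, pairAction_apply, Prod.smul_fst, Prod.smul_snd, rowAction_smul,
    rowAction_smul, map_sub]

theorem exists_pairAction_eq {m n : ℕ}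
    (μ : Module.Dual k ((Fin m → k[T;T⁻¹]) × (Fin n → k[T;T⁻¹]))) :
    ∃ (x : ℤ → Fin m → k) (y : ℤ → Fin n → k), ∀ p, pairAction x y p 0 = μ p := by
  obtain ⟨x, hx⟩ := exists_rowAction_eq (μ ∘ₗ LinearMap.inl k _ _)
  obtain ⟨y, hy⟩ := exists_rowAction_eq (-(μ ∘ₗ LinearMap.inr k _ _))
  refine ⟨x, y, fun p => ?_⟩
  rw [pairAction_apply, Pi.sub_apply, hx, hy, LinearMap.neg_apply, sub_neg_eq_add]
  simp [← map_add]

/-- A functional on rows that vanishes on a submodule over the Laurent polynomials gives the zero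
trajectory there, since multiplication by powers of the variable moves every time to `0`. -/
theorem pairAction_eq_zero_of_forall {m n : ℕ} {x : ℤ → Fin m → k} {y : ℤ → Fin n → k}
    {N : Submodule k[T;T⁻¹] ((Fin m → k[T;T⁻¹]) × (Fin n → k[T;T⁻¹]))}
    (h : ∀ p ∈ N, pairAction x y p 0 = 0) {p : (Fin m → k[T;T⁻¹]) × (Fin n → k[T;T⁻¹])}
    (hp : p ∈ N) : pairAction x y p = 0 := by
  funext t
  have := h _ (N.smul_mem (LaurentPolynomial.T (-t)) hp)
  rwa [pairAction_smul, laurentAction_T, sub_neg_eq_add, zero_add] at this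

theorem mem_cospanBehaviour_iff {X Y Z : MatProp k[T;T⁻¹]} (A : X ⟶ Z) (B : Y ⟶ Z)
    (x : ℤ → Fin X.dim → k) (y : ℤ → Fin Y.dim → k) :
    (x, y) ∈ cospanBehaviour (toMatrix A) (toMatrix B) ↔
      ∀ p ∈ Corelation.rowModule A B, pairAction x y p = 0 := by
  change theta (toMatrix A) x = theta (toMatrix B) y ↔ _
  constructor
  · rintro h p hp
    obtain ⟨u, h₁, h₂⟩ := Corelation.mem_rowModule.1 hp
    rw [pairAction_apply, ← h₁, ← h₂, ← rowAction_theta, ← rowAction_theta, h, sub_self]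
  · intro h
    refine rowAction_injective fun u => ?_
    have := h (u ᵥ* toMatrix A, u ᵥ* toMatrix B) (Corelation.mem_rowModule.2 ⟨u, rfl, rfl⟩)
    rw [pairAction_apply, ← rowAction_theta, ← rowAction_theta, sub_eq_zero] at this
    rw [this]

/-- A pair of rows annihilated by the whole behaviour lies in the module of rows: a subspace is
the intersection of the kernels of the functionals that vanish on it. -/
theorem mem_rowModule_of_forall_pairAction {X Y Z : MatProp k[T;T⁻¹]} {A : X ⟶ Z} {B : Y ⟶ Z}
    {p : (Fin X.dim → k[T;T⁻¹]) × (Fin Y.dim → k[T;T⁻¹])}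
    (h : ∀ x y, (x, y) ∈ cospanBehaviour (toMatrix A) (toMatrix B) → pairAction x y p = 0) :
    p ∈ Corelation.rowModule A B := by
  by_contra hp
  obtain ⟨μ, hμ, hN⟩ := Submodule.exists_le_ker_of_notMem
    (p := (Corelation.rowModule A B).restrictScalars k) (v := p) hp
  obtain ⟨x, y, hxy⟩ := exists_pairAction_eq μ
  refine hμ ?_
  rw [← hxy, h x y]
  · rfl
  · exact (mem_cospanBehaviour_iff A B x y).2 fun q hq =>
      pairAction_eq_zero_of_forall (fun r hr => (hxy r).trans (hN hr)) hq

/-- Trajectories that annihilate the kernel of `(p, r) ↦ p P - r S` come from a trajectory of the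
apex, because a functional that vanishes on the kernel of a linear map over a field factors through
that map. -/
theorem annihilates_ker_spanMap_iff {m e n : ℕ} (P : Matrix (Fin m) (Fin e) k[T;T⁻¹])
    (S : Matrix (Fin n) (Fin e) k[T;T⁻¹]) (x : ℤ → Fin m → k) (y : ℤ → Fin n → k) :
    (∀ p ∈ LinearMap.ker (Corelation.spanMap P S), pairAction x y p = 0) ↔
      ∃ v, theta P v = x ∧ theta S v = y := by
  constructor
  · intro h
    have hmem : LinearMap.proj 0 ∘ₗ pairAction x y ∈ LinearMap.range
        ((Corelation.spanMap P S).restrictScalars k).dualMap := by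
      rw [LinearMap.range_dualMap_eq_dualAnnihilator_ker, Submodule.mem_dualAnnihilator]
      intro p hp
      exact congrFun (h p hp) 0
    obtain ⟨μ, hμ⟩ := hmem
    obtain ⟨v, hv⟩ := exists_rowAction_eq μ
    have key : ∀ p r, rowAction v (p ᵥ* P) 0 - rowAction v (r ᵥ* S) 0 =
        rowAction x p 0 - rowAction y r 0 := by
      intro p r
      have := LinearMap.congr_fun hμ (p, r)
      rw [LinearMap.dualMap_apply, LinearMap.restrictScalars_apply, Corelation.spanMap_apply,
        map_sub, ← hv, ← hv] at this
      rw [this]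
      simp [pairAction_apply]
    refine ⟨v, rowAction_injective fun p => ?_, rowAction_injective fun r => ?_⟩
    · simpa [rowAction_theta] using key p 0
    · simpa [rowAction_theta] using key 0 r
  · rintro ⟨v, rfl, rfl⟩ p hp
    rw [LinearMap.mem_ker, Corelation.spanMap_apply] at hp
    rw [pairAction_apply, rowAction_theta, rowAction_theta, ← map_sub, hp, map_zero]

theorem behaviour_ofSpan {m e n : ℕ} (P : Matrix (Fin m) (Fin e) k[T;T⁻¹])
    (S : Matrix (Fin n) (Fin e) k[T;T⁻¹]) :
    behaviour (CorelMat.ofSpan P S) = LinearMap.range ((theta P).prod (theta S)) := by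
  ext ⟨x, y⟩
  refine (mem_cospanBehaviour_iff _ _ x y).trans ?_
  rw [Corelation.rowModule_comp_ofHomOp_ofHom]
  refine (annihilates_ker_spanMap_iff P S x y).trans ?_
  simp [Prod.ext_iff]

/-! ### Finite memory -/

theorem laurentAction_delay (p : k[T;T⁻¹]) (w : ℤ → k) (c t : ℤ) :
    laurentAction k p (fun τ => w (τ - c)) t = laurentAction k p w (t - c) := by
  rw [laurentAction_apply, laurentAction_apply]
  simp only [sub_right_comm]

theorem theta_delay {m n : ℕ} (A : Matrix (Fin n) (Fin m) k[T;T⁻¹]) (w : ℤ → Fin m → k)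
    (c t : ℤ) : theta A (fun τ => w (τ - c)) t = theta A w (t - c) := by
  funext i
  simp only [theta_apply, rowAction_apply, Finset.sum_apply]
  exact Finset.sum_congr rfl fun j _ => laurentAction_delay _ (fun τ => w τ j) c t

/-- The value of `p · w` at a time depends only on the values of `w` in a window around it. -/
theorem exists_laurentAction_window (p : k[T;T⁻¹]) :
    ∃ N₀ : ℤ, ∀ N ≥ N₀, ∀ (w w' : ℤ → k) (t : ℤ), (∀ τ, |τ - t| ≤ N → w τ = w' τ) →
      laurentAction k p w t = laurentAction k p w' t := by
  obtain ⟨N₀, hN⟩ := (p.coeff.support.image fun i => |i|).exists_le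
  refine ⟨N₀, fun N hN' w w' t h => ?_⟩
  rw [laurentAction_apply, laurentAction_apply]
  refine Finset.sum_congr rfl fun i hi => ?_
  dsimp only
  rw [h]
  rw [sub_sub_cancel_left, abs_neg]
  exact (hN _ (Finset.mem_image_of_mem _ hi)).trans hN'

theorem exists_rowAction_window {n : ℕ} (p : Fin n → k[T;T⁻¹]) :
    ∃ N₀ : ℤ, ∀ N ≥ N₀, ∀ (w w' : ℤ → Fin n → k) (t : ℤ), (∀ τ, |τ - t| ≤ N → w τ = w' τ) →
      rowAction w p t = rowAction w' p t := by
  choose N hN using fun j => exists_laurentAction_window (p j)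
  obtain ⟨N₀, hN₀⟩ := Finite.exists_le N
  refine ⟨N₀, fun M hM w w' t h => ?_⟩
  simp only [rowAction_apply, Finset.sum_apply]
  exact Finset.sum_congr rfl fun j _ =>
    hN j M ((hN₀ j).trans hM) _ _ t fun τ hτ => congrFun (h τ hτ) j

theorem exists_theta_window {m n : ℕ} (A : Matrix (Fin n) (Fin m) k[T;T⁻¹]) :
    ∃ N₀ : ℤ, ∀ N ≥ N₀, ∀ (w w' : ℤ → Fin m → k) (t : ℤ), (∀ τ, |τ - t| ≤ N → w τ = w' τ) →
      theta A w t = theta A w' t := by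
  choose N hN using fun i => exists_rowAction_window (A i)
  obtain ⟨N₀, hN₀⟩ := Finite.exists_le N
  refine ⟨N₀, fun M hM w w' t h => funext fun i => ?_⟩
  rw [theta_apply, theta_apply]
  exact hN i M ((hN₀ i).trans hM) w w' t h

/-- A trajectory with zero future that solves a nontrivial recurrence is zero: at the last time
where it does not vanish, only the highest power of the variable contributes. -/
theorem eq_zero_of_laurentAction_eq_zero {q : k[T;T⁻¹]} (hq : q ≠ 0) {y : ℤ → k}
    (hy : laurentAction k q y = 0) {t₁ : ℤ} (h : ∀ t ≥ t₁, y t = 0) : y = 0 := by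
  by_contra hne
  obtain ⟨s, hs⟩ := Function.ne_iff.1 hne
  obtain ⟨t, ht, hmax⟩ := Int.exists_greatest_of_bdd (P := fun t => y t ≠ 0)
    ⟨t₁, fun z hz => le_of_not_ge fun hz' => hz (h z hz')⟩ ⟨s, hs⟩
  have hsupp : q.coeff.support.Nonempty := by
    rw [Finsupp.support_nonempty_iff]
    exact fun h0 => hq (AddMonoidAlgebra.coeff_injective h0)
  have hi := q.coeff.support.max'_mem hsupp
  set i := q.coeff.support.max' hsupp
  have h0 := congrFun hy (t + i)
  rw [laurentAction_apply, Finsupp.sum, Finset.sum_eq_single_of_mem i hi] at h0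
  · rw [add_sub_cancel_right, Pi.zero_apply] at h0
    exact (mul_ne_zero (Finsupp.mem_support_iff.1 hi) ht) h0
  · intro j hj hji
    have hlt : j < i := lt_of_le_of_ne (q.coeff.support.le_max' j hj) hji
    have : y (t + i - j) = 0 := by
      by_contra hne'
      have := hmax _ hne'
      omega
    rw [this, mul_zero]

/-! ### Controllability -/

/-- Images are controllable: trajectories of the apex can be concatenated freely, and the
concatenation is made beyond the reach of the window of `θ P` and `θ S`. -/
theorem isControllable_range_theta {m e n : ℕ} (P : Matrix (Fin m) (Fin e) k[T;T⁻¹])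
    (S : Matrix (Fin n) (Fin e) k[T;T⁻¹]) :
    IsControllable (trajectories (LinearMap.range ((theta P).prod (theta S)) :
      Set ((ℤ → Fin m → k) × (ℤ → Fin n → k)))) := by
  rintro w ⟨v, hv⟩ w' ⟨v', hv'⟩ t₀
  obtain ⟨N₁, hN₁⟩ := exists_theta_window P
  obtain ⟨N₂, hN₂⟩ := exists_theta_window S
  set N := max 0 (max N₁ N₂)
  have h0 : 0 ≤ N := le_max_left _ _
  have h1 : N₁ ≤ N := (le_max_left _ _).trans (le_max_right _ _)
  have h2 : N₂ ≤ N := (le_max_right _ _).trans (le_max_right _ _)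
  -- The window of `t₀` ends at `t₀ + N`, and the window of `t₁` starts right after it.
  set t₁ := t₀ + 2 * N + 1
  let v'' : ℤ → Fin e → k := fun τ => if τ ≤ t₀ + N then v τ else v' (τ - t₁)
  have hpast : ∀ t ≤ t₀, ∀ τ, |τ - t| ≤ N → v'' τ = v τ := fun t ht τ hτ =>
    if_pos (by have := abs_le.1 hτ; omega)
  have hfuture : ∀ t ≥ t₁, ∀ τ, |τ - t| ≤ N → v'' τ = v' (τ - t₁) := fun t ht τ hτ =>
    if_neg (by have := abs_le.1 hτ; omega)
  have hw : ∀ t, w t = (theta P v t, theta S v t) := fun t =>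
    Prod.ext (congrFun (congrArg Prod.fst hv) t).symm (congrFun (congrArg Prod.snd hv) t).symm
  have hw' : ∀ t, w' t = (theta P v' t, theta S v' t) := fun t =>
    Prod.ext (congrFun (congrArg Prod.fst hv') t).symm (congrFun (congrArg Prod.snd hv') t).symm
  refine ⟨fun t => (theta P v'' t, theta S v'' t), ⟨v'', rfl⟩, t₁, by omega, fun t ht => ?_,
    fun t ht => ?_⟩
  · dsimp only
    rw [hw, hN₁ N h1 _ _ t (hpast t ht), hN₂ N h2 _ _ t (hpast t ht)]
  · dsimp only
    rw [hw', hN₁ N h1 _ _ t (hfuture t ht), hN₂ N h2 _ _ t (hfuture t ht), theta_delay,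
      theta_delay]

/-- The module of rows of a cospan with controllable behaviour is saturated. If `q p` is in it,
then `p` maps every trajectory `w` of the behaviour to a solution of the recurrence `q`. Steering
`w` to zero does not change this solution in the past and makes it vanish in the future, so it
is zero. -/
theorem mem_rowModule_of_smul_mem {X Y Z : MatProp k[T;T⁻¹]} {A : X ⟶ Z} {B : Y ⟶ Z}
    (hc : IsControllable (trajectories (cospanBehaviour (toMatrix A) (toMatrix B) :
      Set ((ℤ → Fin X.dim → k) × (ℤ → Fin Y.dim → k)))))
    {q : k[T;T⁻¹]} {p : (Fin X.dim → k[T;T⁻¹]) × (Fin Y.dim → k[T;T⁻¹])} (hq : q ≠ 0)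
    (hp : q • p ∈ Corelation.rowModule A B) : p ∈ Corelation.rowModule A B := by
  refine mem_rowModule_of_forall_pairAction fun x y hxy => funext fun t => ?_
  obtain ⟨N₁, hN₁⟩ := exists_rowAction_window p.1
  obtain ⟨N₂, hN₂⟩ := exists_rowAction_window p.2
  set N := max N₁ N₂
  have hwin : ∀ (x x' : ℤ → Fin X.dim → k) (y y' : ℤ → Fin Y.dim → k) (t : ℤ),
      (∀ τ, |τ - t| ≤ N → x τ = x' τ ∧ y τ = y' τ) → pairAction x y p t = pairAction x' y' p t := by
    intro x x' y y' t h
    rw [pairAction_apply, pairAction_apply, Pi.sub_apply, Pi.sub_apply,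
      hN₁ N (le_max_left _ _) x x' t fun τ hτ => (h τ hτ).1,
      hN₂ N (le_max_right _ _) y y' t fun τ hτ => (h τ hτ).2]
  obtain ⟨w, hw, t₁, -, hpast, hfuture⟩ := hc (fun τ => (x τ, y τ)) hxy 0
    (zero_mem (cospanBehaviour (toMatrix A) (toMatrix B))) (t + N)
  rw [← hwin (fun τ => (w τ).1) x (fun τ => (w τ).2) y t]
  · refine congrFun (eq_zero_of_laurentAction_eq_zero hq (t₁ := t₁ + N) ?_ fun t' ht' => ?_) t
    · rw [← pairAction_smul]
      exact (mem_cospanBehaviour_iff A B _ _).1 hw _ hp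
    · rw [hwin _ 0 _ 0 t']
      · simp [pairAction_apply, rowAction_apply, ← Pi.zero_def]
      · intro τ hτ
        have := hfuture τ (by have := abs_le.1 hτ; omega)
        simp [this]
  · intro τ hτ
    have := hpast τ (by have := abs_le.1 hτ; omega)
    simp [this]

end Duality

end

theorem mainTheorem3 {k : Type*} [Field k] {m d n : ℕ}
    (A : Matrix (Fin d) (Fin m) k[T;T⁻¹]) (B : Matrix (Fin d) (Fin n) k[T;T⁻¹])
    (hAB : Epi (MatProp.copair (MatProp.ofMatrix A) (MatProp.ofMatrix B))) :
    (IsControllable (trajectories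
        (behaviour (CorelMat.ofCospan A B hAB) : Set ((ℤ → Fin m → k) × (ℤ → Fin n → k)))) ↔
      ∃ (e : ℕ) (R : Matrix (Fin m) (Fin e) k[T;T⁻¹]) (S : Matrix (Fin n) (Fin e) k[T;T⁻¹]),
        CorelMat.ofSpan R S = CorelMat.ofCospan A B hAB) ∧
    ∀ (e : ℕ) (R : Matrix (Fin m) (Fin e) k[T;T⁻¹]) (S : Matrix (Fin n) (Fin e) k[T;T⁻¹]),
      behaviour (CorelMat.ofSpan R S) = LinearMap.range ((theta R).prod (theta S)) := by
  refine ⟨⟨fun hc => ?_, ?_⟩, fun e R S => behaviour_ofSpan R S⟩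
  · obtain ⟨e, R, S, h⟩ := Corelation.exists_ker_spanMap_eq
      (Corelation.rowModule (MatProp.ofMatrix A) (MatProp.ofMatrix B))
      fun q p hq hp => mem_rowModule_of_smul_mem hc hq hp
    exact ⟨e, R, S, Corelation.ofSpan_eq_ofCospan_iff.2 h⟩
  · rintro ⟨e, R, S, h⟩
    rw [← h, behaviour_ofSpan]
    exact isControllable_range_theta R S
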